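/- Let $\mathbf{k}$ be a field and $X=\{x_1,\dots,x_n\}$ a finite set with a fixed enumeration, $n\ge 1$. For a map $r:X\times X\to X\times X$, written $r(x,y)=({}^xy,x^y)$, the pair $(X,r)$ is called a quadratic set (no Yang-Baxter equation is assumed). It is left nondegenerate if $y\mapsto{}^xy$ is bijective for each $x\in X$, and idempotent if $r^2=r$. Its associated quadratic algebra is $A=\mathbf{k}\langle X\rangle/I$, where $I$ is the two-sided ideal generated by all $xy-y'x'$ with $r(x,y)=(y',x')\ne(x,y)$. It is graded by length, $A=\bigoplus_{d\ge0}A_d$, and $I_2=I\cap \mathbf{k}X^2$ denotes the space of quadratic relations. $A$ is called PBW with PBW generators $x_1,\dots,x_n$ if $I$ has a finite Gröbner basis consisting of homogeneous quadratic polynomials with respect to the degree-lexicographic order with $x_1<\dots<x_n$. The Gelfand-Kirillov dimension of $A$ is the least degree $p$ of a polynomial $f$ with integer coefficients such that $\sum_{i\le d}\dim A_i\le f(d)$ for all $d\ge2$. Suppose that $(X,r)$ is a left nondegenerate idempotent quadratic set. (1) $\dim A_2\ge n$, and $I$ is generated by exactly $n(n-1)$ linearly independent quadratic relations, i.e. $\dim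 I_2=n(n-1)$. The lower bound is sharp: for every field $\mathbf{k}$ and every $n\ge1$ there is a left nondegenerate idempotent quadratic set on $X$ for which $\dim A_2=n$. (2) Suppose in addition that $A$ is a PBW algebra with PBW generators $x_1,\dots,x_n$. (i) If $\dim A_2=n$, then $\dim A_d=n$ for all $d\ge1$. (ii) If $A$ has Gelfand-Kirillov dimension $1$, then $\dim A_2\le\binom n2+1$. -/

import Mathlib

namespace QuadraticSet

/-! ### Quadratic sets -/

/-- `(X, r)` is left nondegenerate: with `r (x, y) = (ˣy, xʸ)`, every left action map
`y ↦ ˣy` is bijective. -/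
def IsLeftNondegenerate {X : Type*} (r : X × X → X × X) : Prop :=
  ∀ x : X, Function.Bijective fun y : X => (r (x, y)).1

/-- `(X, r)` is idempotent: `r² = r`. -/
def IsIdempotent {X : Type*} (r : X × X → X × X) : Prop :=
  ∀ p : X × X, r (r p) = r p

/-! ### The free associative algebra and the algebra of a quadratic set -/

/-- The free unital associative algebra `k⟨X⟩`, in its model with the words in `X` as a basis:
the monoid algebra of the free monoid on `X`. The coefficient of `f` at the word `u` is
`f.coeff u`. -/
abbrev FreeAlg (k X : Type*) [Field k] : Type _ := MonoidAlgebra k (FreeMonoid X)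

/-- A word as an element of `k⟨X⟩`. -/
noncomputable def word (k : Type*) [Field k] {X : Type*} (u : FreeMonoid X) : FreeAlg k X :=
  MonoidAlgebra.of k (FreeMonoid X) u

/-- The homogeneous component `k Xᵐ` of `k⟨X⟩`: the span of the words of length `m`. -/
noncomputable def homogeneous (k X : Type*) [Field k] (m : ℕ) : Submodule k (FreeAlg k X) :=
  Submodule.span k (word k '' {u : FreeMonoid X | u.length = m})

/-- The word `x y` of length two attached to a pair `(x, y)`. -/
def pairWord {X : Type*} (p : X × X) : FreeMonoid X :=
  FreeMonoid.of p.1 * FreeMonoid.of p.2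

/-- The defining relations `xy - y'x'`, where `r (x, y) = (y', x') ≠ (x, y)`. -/
def relations (k : Type*) [Field k] {X : Type*} (r : X × X → X × X) : Set (FreeAlg k X) :=
  {f | ∃ p : X × X, r p ≠ p ∧ f = word k (pairWord p) - word k (pairWord (r p))}

/-- The two-sided ideal `I` of `k⟨X⟩` generated by the defining relations. -/
noncomputable def relIdeal (k : Type*) [Field k] {X : Type*} (r : X × X → X × X) :
    TwoSidedIdeal (FreeAlg k X) :=
  TwoSidedIdeal.span (relations k r)

/-- The graded component `I_m = I ∩ k Xᵐ` of the ideal of relations. -/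
noncomputable def relComponent (k : Type*) [Field k] {X : Type*} (r : X × X → X × X) (m : ℕ) :
    Submodule k (FreeAlg k X) :=
  (TwoSidedIdeal.asIdeal (relIdeal k r)).restrictScalars k ⊓ homogeneous k X m

/-- The associated quadratic algebra `A = A(k, X, r) = k⟨X⟩ / I`. -/
abbrev QAlgebra (k : Type*) [Field k] {X : Type*} (r : X × X → X × X) : Type _ :=
  (relIdeal k r).ringCon.Quotient

/-- The graded component `A_m`: the image of `k Xᵐ` in `A`. -/
noncomputable def component (k : Type*) [Field k] {X : Type*} (r : X × X → X × X) (m : ℕ) :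
    Submodule k (QAlgebra k r) :=
  (homogeneous k X m).map ((relIdeal k r).ringCon.mkₐ (α := k)).toLinearMap

/-- `dim A_m`. -/
noncomputable def dimComponent (k : Type*) [Field k] {X : Type*} (r : X × X → X × X) (m : ℕ) :
    ℕ :=
  Module.finrank k (component k r m)

/-- The graded algebra `A` has (finite) Gelfand-Kirillov dimension `p`: `p` is the least degree
of a polynomial with integer coefficients that bounds `dim A_0 + ⋯ + dim A_d` for all `d ≥ 2`. -/
def HasGKDim (k : Type*) [Field k] {X : Type*} (r : X × X → X × X) (p : ℕ) : Prop :=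
  IsLeast
    {q : ℕ | ∃ f : Polynomial ℤ, f.natDegree = q ∧
      ∀ d : ℕ, 2 ≤ d →
        ((∑ i ∈ Finset.range (d + 1), dimComponent k r i : ℕ) : ℤ) ≤ f.eval (d : ℤ)}
    p

/-! ### Gröbner bases and PBW algebras -/

/-- The strict degree-lexicographic order on words for the enumeration `x_0 < x_1 < ⋯` of `X`. -/
def DegLexLT {X : Type*} {n : ℕ} (x : Fin n ≃ X) (u v : FreeMonoid X) : Prop :=
  u.length < v.length ∨
    (u.length = v.length ∧
      List.Lex (fun a b : X => x.symm a < x.symm b) u.toList v.toList)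

/-- `u` is the leading monomial of `f` (in particular `f ≠ 0`). -/
def IsLeadingMonomial {k : Type*} [Field k] {X : Type*} {n : ℕ} (x : Fin n ≃ X)
    (f : FreeAlg k X) (u : FreeMonoid X) : Prop :=
  f.coeff u ≠ 0 ∧ ∀ v : FreeMonoid X, f.coeff v ≠ 0 → v ≠ u → DegLexLT x v u

/-- `G` is a Gröbner basis of the two-sided ideal `I` for the deg-lex order given by the
enumeration `x`: it consists of monic polynomials, generates `I`, and the leading monomial of
every nonzero element of `I` contains the leading monomial of some element of `G` as a subword. -/
def IsGroebnerBasis {k : Type*} [Field k] {X : Type*} {n : ℕ} (x : Fin n ≃ X)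
    (G : Set (FreeAlg k X)) (I : TwoSidedIdeal (FreeAlg k X)) : Prop :=
  (∀ g ∈ G, ∃ u : FreeMonoid X, IsLeadingMonomial x g u ∧ g.coeff u = 1) ∧
  TwoSidedIdeal.span G = I ∧
  ∀ f ∈ I, ∀ u : FreeMonoid X, IsLeadingMonomial x f u →
    ∃ g ∈ G, ∃ v : FreeMonoid X, IsLeadingMonomial x g v ∧
      ∃ a b : FreeMonoid X, u = a * v * b

/-- `A(k, X, r)` is a PBW algebra with PBW generators `x_0, x_1, …`, taken with exactly this
enumeration: its ideal of relations has a finite Gröbner basis of homogeneous quadratic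
polynomials. -/
def IsPBW (k : Type*) [Field k] {X : Type*} (r : X × X → X × X) {n : ℕ} (x : Fin n ≃ X) :
    Prop :=
  ∃ G : Set (FreeAlg k X), G.Finite ∧ (∀ g ∈ G, g ∈ homogeneous k X 2) ∧
    IsGroebnerBasis x G (relIdeal k r)

end QuadraticSet

/-!
Call `(r p).1` the *class letter* of a pair `p`. For a left nondegenerate idempotent `r`, the pair
`r p` is determined by its class letter `z`: it is fixed by `r`, and `t ↦ (r (z, t)).1` takes the
value `z` only once. So two words of length two are identified in `A` as soon as their class
letters agree. Conversely, the linear map sending a word of length two to the basis vector of its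
class letter, and every other word to `0`, kills the ideal of relations
(`classMap_eq_zero_of_mem`). There are hence exactly `n` classes, and by left nondegeneracy each of
them contains exactly one word `a y` for every fixed letter `a`. Thus the words `a y`, `y ∈ X`, form
a basis of `A₂`, whence `dim A₂ = n` and `dim I₂ = n² - n`.

Rewriting the first two letters again and again shows that the `n` words `aᵈ y` span `A_{d+1}`
(`exists_normalWord_eq`). In the PBW case take `a` to be the least letter. If a nonzero combination
of the words `aᵈ y` lay in `I`, then its leading monomial would contain the leading monomial of
some quadratic element `g` of the Gröbner basis, necessarily a word `a y`. Since `a` is the least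
letter, all words of `g` would start with `a`, contradicting the independence of the words `a y`
modulo `I` (`eq_zero_of_isPBW`). So `dim A_d = n` for all `d ≥ 1`.

Since `dim A₂ = n` holds in all cases, the bound `dim A₂ ≤ n.choose 2 + 1` amounts to
`(n - 1) (n - 2) ≥ 0`, and any example, such as `r (x, y) = (y, y)`, shows sharpness.
-/

namespace QuadraticSet

open FreeMonoid

variable {k : Type*} [Field k] {X : Type*}

/-! ### Words -/

lemma word_mul (u v : FreeMonoid X) : word k (u * v) = word k u * word k v :=
  map_mul (MonoidAlgebra.of k (FreeMonoid X)) u v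

lemma coeff_word (u : FreeMonoid X) : (word k u).coeff = Finsupp.single u 1 := rfl

lemma linearIndependent_word : LinearIndependent k (word k : FreeMonoid X → FreeAlg k X) :=
  (MonoidAlgebra.basis (FreeMonoid X) k).linearIndependent

lemma coeff_eq_zero_of_mem_homogeneous {m : ℕ} {f : FreeAlg k X} (hf : f ∈ homogeneous k X m)
    {u : FreeMonoid X} (hu : u.length ≠ m) : f.coeff u = 0 := by
  induction hf using Submodule.span_induction with
  | mem f hf =>
    obtain ⟨v, hv, rfl⟩ := hf
    rw [coeff_word, Finsupp.single_eq_of_ne]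
    rintro rfl
    exact hu hv
  | zero => rfl
  | add f g _ _ hf hg => simp [hf, hg]
  | smul c f _ hf => simp [hf]

lemma toList_of_pow (a : X) (d : ℕ) : (of a ^ d).toList = List.replicate d a := by
  induction d with
  | zero => rfl
  | succ d ih => rw [pow_succ', toList_of_mul, ih, List.replicate_succ]

/-- The word `aᵈ y`. -/
def normalWord (a : X) (d : ℕ) (y : X) : FreeMonoid X := of a ^ d * of y

lemma toList_normalWord (a : X) (d : ℕ) (y : X) :
    (normalWord a d y).toList = List.replicate d a ++ [y] := by
  rw [normalWord, toList_mul, toList_of_pow, toList_of]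

lemma length_normalWord (a : X) (d : ℕ) (y : X) : (normalWord a d y).length = d + 1 := by
  change (normalWord a d y).toList.length = d + 1
  simp only [toList_normalWord, List.length_append, List.length_replicate, List.length_singleton]

lemma normalWord_injective (a : X) (d : ℕ) : Function.Injective (normalWord a d) := fun y z h => by
  have := congrArg toList h
  simpa [toList_normalWord] using this

lemma normalWord_one (a y : X) : normalWord a 1 y = pairWord (a, y) := by
  simp [normalWord, pairWord]

lemma toList_pairWord (p : X × X) : (pairWord p).toList = [p.1, p.2] := rfl

lemma exists_eq_pairWord {u : FreeMonoid X} (hu : u.length = 2) : ∃ p, u = pairWord p := by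
  obtain ⟨b, c, h⟩ := List.length_eq_two.1 (show u.toList.length = 2 from hu)
  exact ⟨(b, c), toList.injective h⟩

/-! ### Class letters and rewriting in the quotient -/

lemma apply_eq_of_fst_eq {r : X × X → X × X} (hl : IsLeftNondegenerate r) (hi : IsIdempotent r)
    {p q : X × X} (h : (r p).1 = (r q).1) : r p = r q := by
  refine Prod.ext h ((hl (r p).1).1 ?_)
  have h₁ : (r ((r p).1, (r p).2)).1 = (r p).1 := congrArg Prod.fst (hi p)
  have h₂ : (r ((r q).1, (r q).2)).1 = (r q).1 := congrArg Prod.fst (hi q)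
  change (r ((r p).1, (r p).2)).1 = (r ((r p).1, (r q).2)).1
  rw [h₁, h, h₂]

/-- The quotient map `k⟨X⟩ → A`. -/
noncomputable def quotMap (k : Type*) [Field k] {X : Type*} (r : X × X → X × X) :
    FreeAlg k X →ₐ[k] QAlgebra k r :=
  (relIdeal k r).ringCon.mkₐ (α := k)

lemma quotMap_eq_zero_iff {r : X × X → X × X} {f : FreeAlg k X} :
    quotMap k r f = 0 ↔ f ∈ relIdeal k r :=
  (RingCon.eq _).trans (TwoSidedIdeal.mem_iff _ _).symm

lemma quotMap_pairWord_apply (r : X × X → X × X) (p : X × X) :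
    quotMap k r (word k (pairWord (r p))) = quotMap k r (word k (pairWord p)) := by
  by_cases h : r p = p
  · rw [h]
  · rw [eq_comm, ← sub_eq_zero, ← map_sub, quotMap_eq_zero_iff]
    exact TwoSidedIdeal.subset_span ⟨p, h, rfl⟩

lemma quotMap_pairWord_eq {r : X × X → X × X} (hl : IsLeftNondegenerate r) (hi : IsIdempotent r)
    {p q : X × X} (h : (r p).1 = (r q).1) :
    quotMap k r (word k (pairWord p)) = quotMap k r (word k (pairWord q)) := by
  rw [← quotMap_pairWord_apply r p, apply_eq_of_fst_eq hl hi h, quotMap_pairWord_apply]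

/-- In the algebra of a left nondegenerate idempotent quadratic set every word of length `d + 1`
equals a word `aᵈ y`, for a letter `a` chosen beforehand: two leading letters `b c` can be replaced
by `a c'`, where `c'` is the letter for which `(b, c)` and `(a, c')` have the same class letter. -/
lemma exists_normalWord_eq {r : X × X → X × X} (hl : IsLeftNondegenerate r)
    (hi : IsIdempotent r) (a : X) {d : ℕ} {u : FreeMonoid X} (hu : u.length = d + 1) :
    ∃ y, quotMap k r (word k u) = quotMap k r (word k (normalWord a d y)) := by
  induction d generalizing u with
  | zero =>
    obtain ⟨y, hy⟩ := List.length_eq_one_iff.1 (show u.toList.length = 1 from hu)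
    exact ⟨y, by rw [show u = of y from toList.injective hy, normalWord, pow_zero, one_mul]⟩
  | succ d ih =>
    match u, hu with
    | b :: c :: v, hu =>
      obtain ⟨c', hc'⟩ := (hl a).2 (r (b, c)).1
      have hv : (of c' * ofList v).length = d + 1 := by
        have : v.length + 2 = d + 2 := hu
        rw [FreeMonoid.length_mul, FreeMonoid.length_of, add_comm]
        exact congrArg Nat.pred this
      obtain ⟨y, hy⟩ := ih hv
      refine ⟨y, ?_⟩
      have h₁ : (b :: c :: v : FreeMonoid X) = pairWord (b, c) * ofList v := rfl
      have h₂ : pairWord (a, c') * ofList v = of a * (of c' * ofList v) := rfl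
      rw [h₁, word_mul, map_mul, quotMap_pairWord_eq hl hi (p := (b, c)) (q := (a, c')) hc'.symm,
        ← map_mul, ← word_mul, h₂, word_mul, map_mul, hy, ← map_mul, ← word_mul, normalWord,
        normalWord, pow_succ', mul_assoc]

/-! ### Independence in degree two -/

/-- The basis vector of the class letter for a word of length two, `0` for any other word. -/
noncomputable def classVec (k : Type*) [Field k] {X : Type*} (r : X × X → X × X) :
    List X → X →₀ k
  | [b, c] => Finsupp.single (r (b, c)).1 1
  | _ => 0

/-- The linear map extending `classVec`; it separates the classes of words of length two. -/
noncomputable def classMap (k : Type*) [Field k] {X : Type*} (r : X × X → X × X) :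
    FreeAlg k X →ₗ[k] X →₀ k :=
  (MonoidAlgebra.basis (FreeMonoid X) k).constr k fun u => classVec k r u.toList

lemma classMap_word (r : X × X → X × X) (u : FreeMonoid X) :
    classMap k r (word k u) = classVec k r u.toList :=
  (MonoidAlgebra.basis (FreeMonoid X) k).constr_basis k _ u

lemma classVec_append {r : X × X → X × X} (hi : IsIdempotent r) (u v : List X) (p : X × X) :
    classVec k r (u ++ ([(r p).1, (r p).2] ++ v)) = classVec k r (u ++ ([p.1, p.2] ++ v)) := by
  match u, v with
  | [], [] =>
    change Finsupp.single (r (r p)).1 (1 : k) = Finsupp.single (r p).1 1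
    rw [hi]
  | [], _ :: _ => rfl
  | [_], _ => rfl
  | [_, _], _ => rfl
  | _ :: _ :: _ :: _, _ => rfl

lemma classMap_mul_relation_mul {r : X × X → X × X} (hi : IsIdempotent r) (f g : FreeAlg k X)
    (p : X × X) :
    classMap k r (f * (word k (pairWord p) - word k (pairWord (r p))) * g) = 0 := by
  induction f using MonoidAlgebra.induction_linear with
  | zero => simp
  | add f₁ f₂ h₁ h₂ => rw [add_mul, add_mul, map_add, h₁, h₂, add_zero]
  | single u c =>
    induction g using MonoidAlgebra.induction_linear with
    | zero => simp
    | add g₁ g₂ h₁ h₂ => rw [mul_add, map_add, h₁, h₂, add_zero]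
    | single v c' =>
      rw [← MonoidAlgebra.smul_of, ← MonoidAlgebra.smul_of, smul_mul_assoc, smul_mul_assoc,
        mul_smul_comm, map_smul, map_smul]
      change c • c' • classMap k r (word k u * _ * word k v) = 0
      rw [mul_sub, sub_mul, map_sub, ← word_mul, ← word_mul, ← word_mul, ← word_mul,
        classMap_word, classMap_word, mul_assoc, mul_assoc, toList_mul, toList_mul, toList_mul,
        toList_mul, toList_pairWord, toList_pairWord, classVec_append hi, sub_self, smul_zero,
        smul_zero]

lemma classMap_eq_zero_of_mem {r : X × X → X × X} (hi : IsIdempotent r) {f : FreeAlg k X}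
    (hf : f ∈ relIdeal k r) : classMap k r f = 0 := by
  rw [relIdeal, TwoSidedIdeal.mem_span_iff_mem_addSubgroup_closure] at hf
  induction hf using AddSubgroup.closure_induction with
  | mem f hf =>
    obtain ⟨_, ⟨a, -, _, ⟨p, -, rfl⟩, rfl⟩, b, -, rfl⟩ := hf
    exact classMap_mul_relation_mul hi a b p
  | zero => exact map_zero _
  | add f g _ _ hf hg => rw [map_add, hf, hg, add_zero]
  | neg f _ hf => rw [map_neg, hf, neg_zero]

lemma classMap_normalWord_one (r : X × X → X × X) (a y : X) :
    classMap k r (word k (normalWord a 1 y)) = Finsupp.single (r (a, y)).1 1 := by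
  rw [classMap_word, normalWord_one]
  rfl

lemma eq_sum_word_of_support [Fintype X] {a : X} {d : ℕ} {f : FreeAlg k X}
    (hf : ∀ v, f.coeff v ≠ 0 → ∃ y, v = normalWord a d y) :
    f = ∑ y, f.coeff (normalWord a d y) • word k (normalWord a d y) := by
  classical
  ext v
  simp only [MonoidAlgebra.coeff_sum, MonoidAlgebra.coeff_smul, coeff_word, Finsupp.coe_finsetSum,
    Finset.sum_apply, Finsupp.smul_apply, Finsupp.single_apply, smul_eq_mul]
  by_cases hv : ∃ y, v = normalWord a d y
  · obtain ⟨y, rfl⟩ := hv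
    simp [(normalWord_injective a d).eq_iff]
  · rw [Finset.sum_eq_zero]
    · exact not_not.1 fun h => hv (hf v h)
    · intro y _
      rw [if_neg fun h => hv ⟨y, h.symm⟩, mul_zero]

/-- The words `a y`, `y ∈ X`, are linearly independent modulo `I`. -/
lemma eq_zero_of_support_normalWord_one [Fintype X] {r : X × X → X × X}
    (hl : IsLeftNondegenerate r) (hi : IsIdempotent r) (a : X) {f : FreeAlg k X}
    (hfI : f ∈ relIdeal k r) (hf : ∀ v, f.coeff v ≠ 0 → ∃ y, v = normalWord a 1 y) : f = 0 := by
  have hsum := eq_sum_word_of_support hf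
  have h0 := classMap_eq_zero_of_mem hi hfI
  have hli : LinearIndependent k fun y : X => (Finsupp.single (r (a, y)).1 1 : X →₀ k) :=
    (Finsupp.basisSingleOne (R := k) (ι := X)).linearIndependent.comp _ (hl a).1
  rw [hsum, map_sum] at h0
  simp only [map_smul, classMap_normalWord_one] at h0
  rw [hsum]
  exact Finset.sum_eq_zero fun y _ => by
    rw [Fintype.linearIndependent_iff.1 hli _ h0 y, zero_smul]

/-! ### Dimensions -/

/-- The words `aᵈ y` always span `A_{d+1}`, so its dimension is the number of letters if they are
linearly independent modulo `I`. -/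
lemma dimComponent_succ_eq [Fintype X] {r : X × X → X × X} (hl : IsLeftNondegenerate r)
    (hi : IsIdempotent r) (a : X) (d : ℕ)
    (h : ∀ f ∈ relIdeal k r, (∀ v, f.coeff v ≠ 0 → ∃ y, v = normalWord a d y) → f = 0) :
    dimComponent k r (d + 1) = Fintype.card X := by
  have hspan : component k r (d + 1) =
      Submodule.span k (Set.range fun y => quotMap k r (word k (normalWord a d y))) := by
    change (homogeneous k X (d + 1)).map (quotMap k r).toLinearMap = _
    rw [homogeneous, Submodule.map_span]
    apply le_antisymm <;> rw [Submodule.span_le]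
    · rintro _ ⟨_, ⟨u, hu, rfl⟩, rfl⟩
      obtain ⟨y, hy⟩ := exists_normalWord_eq (k := k) hl hi a hu
      exact Submodule.subset_span ⟨y, hy.symm⟩
    · rintro _ ⟨y, rfl⟩
      exact Submodule.subset_span ⟨_, ⟨_, length_normalWord a d y, rfl⟩, rfl⟩
  rw [dimComponent, hspan]
  refine finrank_span_eq_card (Fintype.linearIndependent_iff.2 fun c hc => ?_)
  have hw : LinearIndependent k fun y => word k (normalWord a d y) :=
    linearIndependent_word.comp _ (normalWord_injective a d)
  refine Fintype.linearIndependent_iff.1 hw c (h _ ?_ fun v hv => ?_)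
  · rw [← quotMap_eq_zero_iff, map_sum]
    simpa only [map_smul] using hc
  · by_contra hne
    refine hv ?_
    simp only [MonoidAlgebra.coeff_sum, MonoidAlgebra.coeff_smul, coeff_word,
      Finsupp.coe_finsetSum, Finset.sum_apply, Finsupp.smul_apply]
    refine Finset.sum_eq_zero fun y _ => ?_
    rw [Finsupp.single_eq_of_ne fun e => hne ⟨y, e⟩, smul_zero]

lemma dimComponent_two_eq [Fintype X] [Nonempty X] {r : X × X → X × X}
    (hl : IsLeftNondegenerate r) (hi : IsIdempotent r) :
    dimComponent k r 2 = Fintype.card X :=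
  dimComponent_succ_eq hl hi (Classical.arbitrary X) 1 fun _ hfI hf =>
    eq_zero_of_support_normalWord_one hl hi _ hfI hf

lemma homogeneous_two_eq_span :
    homogeneous k X 2 = Submodule.span k (Set.range fun p => word k (pairWord p)) := by
  rw [homogeneous]
  congr 1
  ext f
  constructor
  · rintro ⟨u, hu, rfl⟩
    obtain ⟨p, rfl⟩ := exists_eq_pairWord hu
    exact ⟨p, rfl⟩
  · rintro ⟨p, rfl⟩
    exact ⟨_, rfl, rfl⟩

lemma linearIndependent_pairWord :
    LinearIndependent k fun p : X × X => word k (pairWord p) :=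
  linearIndependent_word.comp _ fun p q h => by
    have := congrArg toList h
    simpa [toList_pairWord, Prod.ext_iff] using this

lemma finrank_relComponent_add_dimComponent_two [Fintype X] (r : X × X → X × X) :
    Module.finrank k (relComponent k r 2) + dimComponent k r 2 =
      Fintype.card X * Fintype.card X := by
  have hfin : Module.finrank k (homogeneous k X 2) = Fintype.card X * Fintype.card X := by
    rw [homogeneous_two_eq_span, finrank_span_eq_card linearIndependent_pairWord,
      Fintype.card_prod]
  have : Module.Finite k (homogeneous k X 2) := by
    rw [homogeneous_two_eq_span]
    exact Module.Finite.span_of_finite k (Set.finite_range _)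
  have h := LinearMap.finrank_range_add_finrank_ker
    ((quotMap k r).toLinearMap.domRestrict (homogeneous k X 2))
  rw [hfin, LinearMap.range_domRestrict, LinearMap.ker_domRestrict] at h
  have hker : relComponent k r 2 = ((LinearMap.ker (quotMap k r).toLinearMap).comap
      (homogeneous k X 2).subtype).map (homogeneous k X 2).subtype := by
    rw [Submodule.map_comap_subtype, relComponent, inf_comm]
    congr 1
    ext f
    exact quotMap_eq_zero_iff.symm
  rw [hker, Submodule.finrank_map_subtype_eq, add_comm]
  exact h

/-! ### The PBW case -/

lemma eq_of_mul_pairWord_mul_eq_normalWord {a y : X} {d : ℕ} {p : X × X} {u v : FreeMonoid X}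
    (h : normalWord a d y = u * pairWord p * v) : p.1 = a := by
  have h' := congrArg (fun w => w.toList.dropLast) h
  simp only [toList_normalWord, toList_mul, toList_pairWord, List.dropLast_concat] at h'
  rw [List.append_assoc, List.dropLast_append_of_ne_nil (by simp)] at h'
  refine List.eq_of_mem_replicate (n := d) ?_
  rw [h']
  simp

/-- If `A` is PBW, then the words `aᵈ y` with `a` the least letter are linearly independent modulo
`I`. -/
lemma eq_zero_of_isPBW [Fintype X] {n : ℕ} {x : Fin n ≃ X} {r : X × X → X × X}
    (hl : IsLeftNondegenerate r) (hi : IsIdempotent r) (hpbw : IsPBW k r x) {a : X}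
    (ha : ∀ b, x.symm a ≤ x.symm b) {d : ℕ} {f : FreeAlg k X} (hfI : f ∈ relIdeal k r)
    (hf : ∀ v, f.coeff v ≠ 0 → ∃ y, v = normalWord a d y) : f = 0 := by
  classical
  obtain ⟨G, -, hG₂, hGm, hGI, hG⟩ := hpbw
  by_contra hf0
  -- The leading monomial of `f` is the word `aᵈ y` in its support with the largest last letter.
  have hne : (Finset.univ.filter fun y => f.coeff (normalWord a d y) ≠ 0).Nonempty := by
    obtain ⟨v, hv⟩ := Finsupp.ne_iff.1 (mt MonoidAlgebra.coeff_eq_zero.1 hf0)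
    obtain ⟨y, rfl⟩ := hf v hv
    exact ⟨y, by simpa using hv⟩
  obtain ⟨y, hy, hmax⟩ := Finset.exists_max_image _ x.symm hne
  have hlead : IsLeadingMonomial x f (normalWord a d y) := by
    refine ⟨by simpa using hy, fun v hv hvy => Or.inr ?_⟩
    obtain ⟨z, rfl⟩ := hf v hv
    refine ⟨by simp only [length_normalWord], ?_⟩
    rw [toList_normalWord, toList_normalWord]
    have hzy : x.symm z < x.symm y :=
      lt_of_le_of_ne (hmax z (by simpa using hv)) fun e => hvy (by rw [x.symm.injective e])
    exact List.Lex.append_left (fun a b => x.symm a < x.symm b) (List.Lex.rel hzy) _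
  obtain ⟨g, hg, v, hv, u₁, u₂, hu⟩ := hG f hfI _ hlead
  have hlen : ∀ w, g.coeff w ≠ 0 → w.length = 2 := fun w hw =>
    not_not.1 fun h => hw (coeff_eq_zero_of_mem_homogeneous (hG₂ g hg) h)
  obtain ⟨⟨b, c⟩, rfl⟩ := exists_eq_pairWord (hlen v hv.1)
  obtain rfl : b = a := eq_of_mul_pairWord_mul_eq_normalWord hu
  -- Every word of `g` is at most `b c`, and `b` is the least letter.
  have hg0 : g = 0 := by
    refine eq_zero_of_support_normalWord_one hl hi b
      (hGI ▸ TwoSidedIdeal.subset_span hg) fun w hw => ?_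
    obtain ⟨⟨b', c'⟩, rfl⟩ := exists_eq_pairWord (hlen w hw)
    suffices b' = b from ⟨c', by rw [normalWord_one, this]⟩
    by_cases hwv : pairWord (b', c') = pairWord (b, c)
    · exact (List.cons.inj (congrArg toList hwv)).1
    · rcases hv.2 _ hw hwv with hlt | ⟨-, hlt⟩
      · exact absurd hlt (lt_irrefl 2)
      · rw [toList_pairWord, toList_pairWord] at hlt
        cases hlt with
        | rel h => exact absurd h (ha b').not_gt
        | cons _ => rfl
  exact hv.1 (by rw [hg0]; rfl)

end QuadraticSet

theorem theorem4 {k : Type*} [Field k] {X : Type*} {n : ℕ} (hn : 1 ≤ n) (x : Fin n ≃ X) :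
    (∀ r : X × X → X × X,
      QuadraticSet.IsLeftNondegenerate r → QuadraticSet.IsIdempotent r →
        n ≤ QuadraticSet.dimComponent k r 2 ∧
        Module.finrank k (QuadraticSet.relComponent k r 2) = n * (n - 1) ∧
        (QuadraticSet.IsPBW k r x →
          (QuadraticSet.dimComponent k r 2 = n →
            ∀ d : ℕ, 1 ≤ d → QuadraticSet.dimComponent k r d = n) ∧
          (QuadraticSet.HasGKDim k r 1 →
            QuadraticSet.dimComponent k r 2 ≤ n.choose 2 + 1))) ∧
    (∃ r : X × X → X × X,
      QuadraticSet.IsLeftNondegenerate r ∧ QuadraticSet.IsIdempotent r ∧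
        QuadraticSet.dimComponent k r 2 = n) := by
  have : Fintype X := Fintype.ofEquiv _ x
  have hcard : Fintype.card X = n := by simpa using (Fintype.card_congr x).symm
  have : NeZero n := ⟨by omega⟩
  have : Nonempty X := ⟨x 0⟩
  have htwo : ∀ r : X × X → X × X, QuadraticSet.IsLeftNondegenerate r →
      QuadraticSet.IsIdempotent r → QuadraticSet.dimComponent k r 2 = n :=
    fun r hl hi => (QuadraticSet.dimComponent_two_eq hl hi).trans hcard
  refine ⟨fun r hl hi => ⟨(htwo r hl hi).ge, ?_, fun hpbw => ⟨fun _ d hd => ?_, fun _ => ?_⟩⟩, ?_⟩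
  · have h := QuadraticSet.finrank_relComponent_add_dimComponent_two (k := k) r
    rw [htwo r hl hi, hcard] at h
    rw [Nat.mul_sub_one]
    omega
  · obtain ⟨d, rfl⟩ := Nat.exists_eq_add_of_le' hd
    have ha : ∀ b, x.symm (x 0) ≤ x.symm b := fun b => by simp
    exact (QuadraticSet.dimComponent_succ_eq hl hi (x 0) d fun f hfI hf =>
      QuadraticSet.eq_zero_of_isPBW hl hi hpbw ha hfI hf).trans hcard
  · rw [htwo r hl hi]
    obtain ⟨m, rfl⟩ := Nat.exists_eq_add_of_le' hn
    rw [Nat.choose_succ_succ' m 1, Nat.choose_one_right]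
    omega
  · have hl : QuadraticSet.IsLeftNondegenerate fun p : X × X => (p.2, p.2) :=
      fun _ => Function.bijective_id
    have hi : QuadraticSet.IsIdempotent fun p : X × X => (p.2, p.2) := fun _ => rfl
    exact ⟨_, hl, hi, htwo _ hl hi⟩
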